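/- Let $\ell$ be an infinite cardinal and let $Y$ be a thick generalized quadrangle of order $(\ell,t)$: each line is incident with $\ell+1$ points, each point is incident with $t+1$ lines, $t \geq 2$, two distinct points are incident with at most one common line, and for each non-incident point-line pair $(x,M)$ there is precisely one point on $M$ collinear with $x$. Let $V$ be a line of $Y$. Give the point set of a line the cofinite topology; an open dense set $B$ of points of a line $U$ of a point-line geometry $X$ defines an open dense subline of $(U,X)$, namely the permutation group $\big(B, (\mathrm{Aut}(X)_U)_B/\mbox{kernel}\big)$ induced on $B$ by the automorphisms of $X$ that stabilize $U$ and $B$. Two lines $(U,X)$ and $(V,Y)$ are birationally equivalent if they have open dense sublines that are equivalent as permutation groups. The abstract line $(A,A)$ is the geometry consisting of one single line $A$ with $\ell+1$ points (so its automorphism group is $\mathrm{Sym}(A)$). A line $U$ of $Y$ is an axis of symmetry if, for each line $M \neq U$ concurrent with $U$, the automorphisms of $Y$ fixing each line concurrent with $U$ act transitively on the points of $M$ not on $U$; a thick generalized quadrangle is a translation generalized quadrangle if it has a point all of whose incident lines are axes of symmetry. Then the abstract line $(A,A)$ is birationally equivalent to $(V,Y)$ if and only if $V$ has an open dense (that is,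 cofinite) set $W$ of points such that the group induced on $W$ by the automorphisms of $Y$ that stabilize $V$ and $W$ is the full symmetric group $\mathrm{Sym}(W)$; and if this is the case, then $Y$ is not a translation generalized quadrangle. -/

import Mathlib

open Cardinal

universe u v u' v'

/-- A point-line incidence structure with point set `P` and line set `L`. -/
structure PointLineGeometry (P : Type u) (L : Type v) where
  /-- `Inc p U`: the point `p` and the line `U` are incident. -/
  Inc : P → L → Prop

namespace PointLineGeometry

variable {P : Type u} {L : Type v}

/-- Two points are collinear if some line is incident with both. -/
def Collinear (Γ : PointLineGeometry P L) (x y : P) : Prop :=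
  ∃ M : L, Γ.Inc x M ∧ Γ.Inc y M

/-- Two lines are concurrent if some point is incident with both. So `{V | Concurrent V U}` is
`U^⊥` (which contains `U` itself as soon as `U` has a point). -/
def Concurrent (Γ : PointLineGeometry P L) (U V : L) : Prop :=
  ∃ p : P, Γ.Inc p U ∧ Γ.Inc p V

/-- `Γ` is a generalized quadrangle of order `(s, t)`, for arbitrary cardinals `s` and `t`. -/
structure IsGQ (Γ : PointLineGeometry P L) (s : Cardinal.{u}) (t : Cardinal.{v}) : Prop where
  /-- Each line is incident with `s + 1` points. -/
  card_points : ∀ U : L, #{p : P // Γ.Inc p U} = s + 1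
  /-- Each point is incident with `t + 1` lines. -/
  card_lines : ∀ p : P, #{U : L // Γ.Inc p U} = t + 1
  /-- Two distinct points are incident with at most one common line. -/
  line_unique : ∀ (p q : P) (U V : L), p ≠ q →
    Γ.Inc p U → Γ.Inc q U → Γ.Inc p V → Γ.Inc q V → U = V
  /-- If `x` is not on `Y`, precisely one point of `Y` is collinear with `x`. -/
  proj : ∀ (x : P) (Y : L), ¬ Γ.Inc x Y → ∃! z : P, Γ.Inc z Y ∧ Γ.Collinear z x

/-- The automorphism group: the pairs consisting of a permutation of the points and a permutation
of the lines that together preserve incidence in both directions. -/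
def Aut (Γ : PointLineGeometry P L) : Subgroup (Equiv.Perm P × Equiv.Perm L) where
  carrier := {g | ∀ p U, Γ.Inc (g.1 p) (g.2 U) ↔ Γ.Inc p U}
  one_mem' := fun _ _ => Iff.rfl
  mul_mem' := by
    intro g h hg hh p U
    exact (hg (h.1 p) (h.2 U)).trans (hh p U)
  inv_mem' := by
    intro g hg p U
    have h := hg (g.1⁻¹ p) (g.2⁻¹ U)
    simpa using h.symm

/-- A symmetry with axis `U`: an automorphism that fixes each line of `U^⊥`. -/
def IsSymmetry (Γ : PointLineGeometry P L) (U : L) (g : Equiv.Perm P × Equiv.Perm L) : Prop :=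
  g ∈ Γ.Aut ∧ ∀ V : L, Γ.Concurrent V U → g.2 V = V

/-- `U` is an axis of symmetry: for each line `V ≠ U` concurrent with `U`, the symmetries with
axis `U` act transitively on the points of `V` that are not on `U`. -/
def IsAxisOfSymmetry (Γ : PointLineGeometry P L) (U : L) : Prop :=
  ∀ V : L, Γ.Concurrent V U → V ≠ U →
    ∀ p q : P, Γ.Inc p V → ¬ Γ.Inc p U → Γ.Inc q V → ¬ Γ.Inc q U →
      ∃ g, Γ.IsSymmetry U g ∧ g.1 p = q

/-- `x` is a translation point: every line incident with `x` is an axis of symmetry. -/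
def IsTranslationPoint (Γ : PointLineGeometry P L) (x : P) : Prop :=
  ∀ U : L, Γ.Inc x U → Γ.IsAxisOfSymmetry U

/-- `Γ` is a translation generalized quadrangle if it has a translation point `x`; the translation
group is then the group generated by the symmetries whose axes are incident with `x`. (To be used
for thick generalized quadrangles only.) -/
def IsTGQ (Γ : PointLineGeometry P L) : Prop :=
  ∃ x : P, Γ.IsTranslationPoint x

/-- The set of points incident with the line `U`. -/
abbrev PointsOn (Γ : PointLineGeometry P L) (U : L) : Type u := {p : P // Γ.Inc p U}

/-- `B` is open and dense in the line `U`, for the cofinite topology on the points of `U`. -/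
def IsOpenDense (Γ : PointLineGeometry P L) (U : L) (B : Set (Γ.PointsOn U)) : Prop :=
  IsOpen (CofiniteTopology.of.symm ⁻¹' B) ∧ Dense (CofiniteTopology.of.symm ⁻¹' B)

/-- The permutation group of the subline `B` of `(U, Γ)`: the group of permutations of `B` that are
induced by automorphisms of `Γ` stabilizing `U` and `B`, that is, the stabilizer of `U` and `B` in
the automorphism group of `Γ` modulo the kernel of its action on `B`. -/
def sublineGroup (Γ : PointLineGeometry P L) (U : L) (B : Set (Γ.PointsOn U)) :
    Subgroup (Equiv.Perm B) where
  carrier := {σ | ∃ g ∈ Γ.Aut, g.2 U = U ∧ ∀ b : B, g.1 (b : Γ.PointsOn U) = (σ b : Γ.PointsOn U)}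
  one_mem' := ⟨1, Γ.Aut.one_mem, rfl, fun _ => rfl⟩
  mul_mem' := by
    rintro σ τ ⟨g, hg, hgU, hgσ⟩ ⟨h, hh, hhU, hhτ⟩
    refine ⟨g * h, Γ.Aut.mul_mem hg hh, ?_, fun b => ?_⟩
    · simp [hgU, hhU]
    · simp [hgσ, hhτ]
  inv_mem' := by
    rintro σ ⟨g, hg, hgU, hgσ⟩
    refine ⟨g⁻¹, Γ.Aut.inv_mem hg, ?_, fun b => ?_⟩
    · exact Equiv.Perm.inv_eq_iff_eq.mpr hgU.symm
    · exact Equiv.Perm.inv_eq_iff_eq.mpr (by simpa using (hgσ (σ⁻¹ b)).symm)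

/-- Equivalence of permutation groups: a bijection of the underlying sets that transports the one
group onto the other. -/
def PermGroupEquivalent {α : Type u} {β : Type u'} (G : Subgroup (Equiv.Perm α))
    (H : Subgroup (Equiv.Perm β)) : Prop :=
  ∃ e : α ≃ β, ∀ σ : Equiv.Perm α, σ ∈ G ↔ e.permCongr σ ∈ H

/-- The lines `(U, Γ)` and `(V, Γ')` are birationally equivalent: they have open dense sublines
that are isomorphic, i.e. equivalent as permutation groups. -/
def LinesBirational {P' : Type u'} {L' : Type v'} (Γ : PointLineGeometry P L) (U : L)
    (Γ' : PointLineGeometry P' L') (V : L') : Prop :=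
  ∃ (B : Set (Γ.PointsOn U)) (C : Set (Γ'.PointsOn V)),
    Γ.IsOpenDense U B ∧ Γ'.IsOpenDense V C ∧
      PermGroupEquivalent (Γ.sublineGroup U B) (Γ'.sublineGroup V C)

/-- The abstract line with point set `A`: one line, incident with all points. -/
def abstractLine (A : Type u) : PointLineGeometry A PUnit.{v + 1} where
  Inc _ _ := True

/-- `(V, Γ)` has an open dense subline of type `(W, W)`: the induced group is `Sym(W)`. -/
def HasFullySymmetricOpenSubline (Γ : PointLineGeometry P L) (V : L) : Prop :=
  ∃ W : Set (Γ.PointsOn V), Γ.IsOpenDense V W ∧ Γ.sublineGroup V W = ⊤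

end PointLineGeometry

/-! Every permutation of a subset of the abstract line is induced by an automorphism, so birational
equivalence with it says exactly that some cofinite `W` on `V` carries all of `Sym(W)`.

For the second claim, a translation point yields an axis of symmetry `U ≠ V` meeting `V` in a point
`x`. The symmetries with axis `U` act regularly on the points of `V` other than `x`. An automorphism
`θ` fixing `V` and `x` conjugates this group into the one belonging to the axis `θ U`, which either
is the same group or commutes with it on `V`. By `perm_eq_one_of_conj_semiregular`, `θ` cannot then
move a nonzero finite number of points of `V` (`fixes_line_of_axis`). But if all transpositions of
`W` are induced, a quotient of two of them, chosen so that it fixes `x`, is such a `θ`. -/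

/-- Let `G` be a transitive semiregular group of permutations of an infinite set, and let `θ`, of
finite support, conjugate `G` into a semiregular group `G'` that is `G` or commutes with `G`. Then
`θ` is the identity. -/
theorem perm_eq_one_of_conj_semiregular {X : Type*} [Infinite X] {G G' : Subgroup (Equiv.Perm X)}
    (htrans : ∀ p q : X, ∃ g ∈ G, g p = q) (hsemi : ∀ g ∈ G, ∀ p, g p = p → g = 1)
    (θ : Equiv.Perm X) (hθ : {p | θ p ≠ p}.Finite) (hconj : ∀ s ∈ G, θ * s * θ⁻¹ ∈ G')
    (hG : G = G' ∨ ∀ g ∈ G, ∀ h ∈ G', g * h = h * g) : θ = 1 := by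
  have hcomm : ∀ s ∈ G, θ * s * θ⁻¹ = s := by
    intro s hs
    set s' := θ * s * θ⁻¹ with hs'
    have hfin : {p | s p ≠ s' p}.Finite := by
      refine (hθ.union (hθ.preimage (f := s) s.injective.injOn)).subset ?_
      intro p hp
      by_contra hcon
      simp only [Set.mem_union, Set.mem_ofPred_eq, Set.mem_preimage, not_or, not_not] at hcon
      refine hp ?_
      have h1 : θ⁻¹ p = p := Equiv.Perm.inv_eq_iff_eq.mpr hcon.1.symm
      rw [hs', Equiv.Perm.mul_apply, Equiv.Perm.mul_apply, h1, hcon.2]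
    obtain ⟨p₀, hp₀⟩ : ∃ p, s p = s' p := by
      by_contra! hcon
      exact Set.infinite_univ (hfin.subset fun p _ => hcon p)
    rcases hG with hG | hG
    · subst hG
      have := hsemi _ (G.mul_mem (G.inv_mem hs) (hconj s hs)) p₀ (by
        rw [Equiv.Perm.mul_apply]
        exact Equiv.Perm.inv_eq_iff_eq.mpr hp₀.symm)
      exact (inv_mul_eq_one.mp this).symm
    -- Via the orbit map at `p₀`, the points where `s` and `s'` agree correspond to the centralizer
    -- of `s` in `G`. If `b` is outside this centralizer, its coset by `b` injects an infinite set
    -- into the finite disagreement set.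
    · have key : ∀ a ∈ G, s (a p₀) = s' (a p₀) ↔ s * a = a * s := by
        intro a ha
        have h1 : s' (a p₀) = a (s p₀) := by
          have := DFunLike.congr_fun (hG a ha s' (hconj s hs)) p₀
          simp only [Equiv.Perm.mul_apply] at this
          rw [← this, hp₀]
        rw [h1]
        constructor
        · intro h
          have := hsemi _ (G.mul_mem (G.inv_mem (G.mul_mem ha hs)) (G.mul_mem hs ha)) p₀ (by
            rw [Equiv.Perm.mul_apply]
            exact Equiv.Perm.inv_eq_iff_eq.mpr h)
          exact (inv_mul_eq_one.mp this).symm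
        · intro h
          exact DFunLike.congr_fun h p₀
      ext q
      by_contra hq
      obtain ⟨b, hb, rfl⟩ := htrans p₀ q
      have hbs : ¬ s * b = b * s := fun h => hq ((key b hb).mpr h).symm
      choose a ha hap using htrans p₀
      have hinf : {p | s p = s' p}.Infinite := by
        have := hfin.infinite_compl
        convert this using 1
        ext p
        simp
      refine hinf.not_finite ?_
      refine Set.Finite.of_injOn (f := fun p => b (a p p₀)) ?_ ?_ hfin
      · intro p hp hcon
        have hp : s (a p p₀) = s' (a p p₀) := by rw [hap]; exact hp
        rw [key _ (ha p)] at hp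
        have h2 := (key _ (G.mul_mem hb (ha p))).mp (by simpa using hcon)
        refine hbs (mul_right_cancel (b := a p) ?_)
        rw [mul_assoc, h2, mul_assoc, mul_assoc, hp]
      · intro p _ q _ h
        simpa [hap] using h
  obtain ⟨p₀, hp₀⟩ : ∃ p, θ p = p := by
    by_contra! hcon
    exact Set.infinite_univ (hθ.subset fun p _ => hcon p)
  ext q
  obtain ⟨g, hg, rfl⟩ := htrans p₀ q
  have h := DFunLike.congr_fun (mul_inv_eq_iff_eq_mul.mp (hcomm g hg)) p₀
  simpa [hp₀] using h

/-! ### Symmetries of generalized quadrangles -/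

namespace PointLineGeometry

variable {P : Type u} {L : Type v} {Γ : PointLineGeometry P L}

theorem IsSymmetry.conj {U : L} {g θ : Equiv.Perm P × Equiv.Perm L} (hg : Γ.IsSymmetry U g)
    (hθ : θ ∈ Γ.Aut) : Γ.IsSymmetry (θ.2 U) (θ * g * θ⁻¹) := by
  refine ⟨Γ.Aut.mul_mem (Γ.Aut.mul_mem hθ hg.1) (Γ.Aut.inv_mem hθ), fun V hV => ?_⟩
  have hinv := Γ.Aut.inv_mem hθ
  obtain ⟨p, hpV, hpU⟩ := hV
  have := hg.2 (θ.2⁻¹ V) ⟨θ.1⁻¹ p, (hinv p V).mpr hpV, by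
    have := (hinv p (θ.2 U)).mpr hpU
    simpa using this⟩
  simp only [Prod.snd_mul, Prod.snd_inv, Equiv.Perm.mul_apply, this]
  exact θ.2.apply_symm_apply V

theorem IsSymmetry.mul {U : L} {g h : Equiv.Perm P × Equiv.Perm L} (hg : Γ.IsSymmetry U g)
    (hh : Γ.IsSymmetry U h) : Γ.IsSymmetry U (g * h) :=
  ⟨Γ.Aut.mul_mem hg.1 hh.1, fun V hV => by simp [hh.2 V hV, hg.2 V hV]⟩

theorem IsSymmetry.inv {U : L} {g : Equiv.Perm P × Equiv.Perm L} (hg : Γ.IsSymmetry U g) :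
    Γ.IsSymmetry U g⁻¹ :=
  ⟨Γ.Aut.inv_mem hg.1, fun V hV => Equiv.Perm.inv_eq_iff_eq.mpr (hg.2 V hV).symm⟩

/-- Incidence is transported by an automorphism that fixes the line. -/
theorem inc_map_of_fix {g : Equiv.Perm P × Equiv.Perm L} (hg : g ∈ Γ.Aut) {V : L}
    (hV : g.2 V = V) {p : P} (hp : Γ.Inc p V) : Γ.Inc (g.1 p) V := by
  have := (hg p V).mpr hp
  rwa [hV] at this

namespace IsGQ

variable {s : Cardinal.{u}} {t : Cardinal.{v}}

theorem point_unique (h : Γ.IsGQ s t) {p q : P} {U V : L} (hUV : U ≠ V) (hpU : Γ.Inc p U)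
    (hpV : Γ.Inc p V) (hqU : Γ.Inc q U) (hqV : Γ.Inc q V) : p = q := by
  by_contra hpq
  exact hUV (h.line_unique p q U V hpq hpU hqU hpV hqV)

/-- There are no triangles. -/
theorem no_triangle (h : Γ.IsGQ s t) {x y z : P} {M N K : L} (hx : ¬ Γ.Inc x M)
    (hyM : Γ.Inc y M) (hzM : Γ.Inc z M) (hxN : Γ.Inc x N) (hyN : Γ.Inc y N)
    (hxK : Γ.Inc x K) (hzK : Γ.Inc z K) : y = z :=
  (h.proj x M hx).unique ⟨hyM, N, hyN, hxN⟩ ⟨hzM, K, hzK, hxK⟩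

theorem exists_third_line (h : Γ.IsGQ s t) (ht : 2 ≤ t) (p : P) (M N : L) :
    ∃ K, Γ.Inc p K ∧ K ≠ M ∧ K ≠ N := by
  by_contra! hcon
  have hsub : {K | Γ.Inc p K} ⊆ {M, N} := by
    intro K hK
    by_cases hKM : K = M
    · exact Or.inl hKM
    · exact Or.inr (hcon K hK hKM)
  have h1 : #{K : L // Γ.Inc p K} ≤ 2 := by
    refine (Cardinal.mk_le_mk_of_subset hsub).trans ?_
    refine (Cardinal.mk_insert_le).trans ?_
    rw [Cardinal.mk_singleton, one_add_one_eq_two]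
  rw [h.card_lines] at h1
  have h2 : (2 : Cardinal) + 1 ≤ 2 := (add_le_add_left ht 1).trans h1
  exact absurd h2 (by norm_num)

theorem infinite_points (h : Γ.IsGQ s t) (hs : ℵ₀ ≤ s) (U : L) : Infinite (Γ.PointsOn U) := by
  rw [Cardinal.infinite_iff, h.card_points]
  exact hs.trans (self_le_add_right _ _)

theorem exists_point_notMem (h : Γ.IsGQ s t) (hs : ℵ₀ ≤ s) (U : L) (F : Set P) (hF : F.Finite) :
    ∃ p, Γ.Inc p U ∧ p ∉ F := by
  have := h.infinite_points hs U
  have hinf : {p | Γ.Inc p U}.Infinite := Set.infinite_coe_iff.mp this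
  obtain ⟨p, hp, hpF⟩ := hinf.exists_notMem_finite hF
  exact ⟨p, hp, hpF⟩

/-- A symmetry with axis `U` that fixes a point `p` off `U` fixes the points of the lines on `p`
that do not meet `U`. -/
theorem symmetry_fixes_of_not_concurrent (h : Γ.IsGQ s t) {U N : L}
    {g : Equiv.Perm P × Equiv.Perm L} (hg : Γ.IsSymmetry U g) {p r : P} (hp : g.1 p = p)
    (hpN : Γ.Inc p N) (hrN : Γ.Inc r N) (hNU : ¬ Γ.Concurrent N U) : g.1 r = r := by
  by_cases hpr : p = r
  · rw [← hpr, hp]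
  -- The line `K` from `r` to `U` is fixed, so if `r` moved, then `p`, `r` and its image on `K`
  -- would form a triangle.
  obtain ⟨y, ⟨hyU, K, hyK, hrK⟩, -⟩ := h.proj r U fun hrU => hNU ⟨r, hrN, hrU⟩
  have hK : g.2 K = K := hg.2 K ⟨y, hyK, hyU⟩
  have hpK : ¬ Γ.Inc p K := fun hpK =>
    hNU (h.line_unique p r N K hpr hpN hrN hpK hrK ▸ ⟨y, hyK, hyU⟩)
  have h1 := (hg.1 p N).mpr hpN
  rw [hp] at h1
  exact h.no_triangle hpK (inc_map_of_fix hg.1 hK hrK) hrK h1 ((hg.1 r N).mpr hrN) hpN hrN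

/-- The symmetries with axis `U` act semiregularly on the points off `U` of a line that
meets `U`. -/
theorem symmetry_semiregular (h : Γ.IsGQ s t) (hs : ℵ₀ ≤ s) (ht : 2 ≤ t) {U V : L}
    (hVU : Γ.Concurrent V U) {g : Equiv.Perm P × Equiv.Perm L}
    (hg : Γ.IsSymmetry U g) {p q : P} (hp : g.1 p = p) (hpV : Γ.Inc p V) (hpU : ¬ Γ.Inc p U)
    (hqV : Γ.Inc q V) (hqU : ¬ Γ.Inc q U) : g.1 q = q := by
  by_cases hpq : p = q
  · rw [← hpq, hp]
  have huniq : ∀ {z : P} {M N : L}, ¬ Γ.Inc z U → Γ.Inc z M → Γ.Inc z N → Γ.Concurrent M U →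
      Γ.Concurrent N U → M = N := by
    rintro z M N hz hzM hzN ⟨a, haM, haU⟩ ⟨b, hbN, hbU⟩
    obtain rfl := h.no_triangle hz haU hbU hzM haM hzN hbN
    exact h.line_unique z a M N (fun hza => hz (hza ▸ haU)) hzM haM hzN hbN
  -- Fixedness spreads along lines missing `U`, so `p` is joined to `q` by a path of three such
  -- lines: `p`, `N`, `r`, `M`, `r'`, `H`, `q`.
  obtain ⟨N, hpN, hNV, -⟩ := h.exists_third_line ht p V V
  have hNU : ¬ Γ.Concurrent N U := fun hc => hNV (huniq hpU hpN hpV hc hVU)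
  obtain ⟨r, hrN, hrp⟩ := h.exists_point_notMem hs N {p} (Set.finite_singleton p)
  have hrp : r ≠ p := hrp
  have hrU : ¬ Γ.Inc r U := fun hr => hNU ⟨r, hrN, hr⟩
  obtain ⟨y, ⟨hyU, K, hyK, hrK⟩, -⟩ := h.proj r U hrU
  obtain ⟨M, hrM, hMN, hMK⟩ := h.exists_third_line ht r N K
  have hMU : ¬ Γ.Concurrent M U := fun hc => hMK (huniq hrU hrM hrK hc ⟨y, hyK, hyU⟩)
  have hrV : ¬ Γ.Inc r V := fun hrV => hNV (h.line_unique r p N V hrp hrN hpN hrV hpV)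
  have hqM : ¬ Γ.Inc q M := fun hqM =>
    hpq (h.no_triangle hrV hpV hqV hrN hpN hrM hqM)
  obtain ⟨r', ⟨hr'M, H, hr'H, hqH⟩, -⟩ := h.proj q M hqM
  have hHU : ¬ Γ.Concurrent H U := fun hc => by
    obtain rfl := huniq hqU hqH hqV hc hVU
    obtain rfl := h.no_triangle hrV hpV hr'H hrN hpN hrM hr'M
    exact hMN (h.line_unique r p M N hrp hrM hr'M hrN hpN)
  have h1 := h.symmetry_fixes_of_not_concurrent hg hp hpN hrN hNU
  have h2 := h.symmetry_fixes_of_not_concurrent hg h1 hrM hr'M hMU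
  exact h.symmetry_fixes_of_not_concurrent hg h2 hr'H hqH hHU

/-- A symmetry with respect to two distinct concurrent axes fixes all points of the other lines on
their intersection point. -/
theorem symmetry_two_axes (h : Γ.IsGQ s t) (hs : ℵ₀ ≤ s) (ht : 2 ≤ t) {U U' V : L} {x v : P}
    (hUU' : U ≠ U') (hxU : Γ.Inc x U) (hxU' : Γ.Inc x U') (hxV : Γ.Inc x V)
    (hvV : Γ.Inc v V) (hvx : v ≠ x) {g : Equiv.Perm P × Equiv.Perm L} (hg : Γ.IsSymmetry U g)
    (hg' : Γ.IsSymmetry U' g) : g.1 v = v := by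
  have hV : g.2 V = V := hg.2 V ⟨x, hxV, hxU⟩
  -- Such a point is the intersection of two distinct fixed lines, one meeting `U` and one meeting
  -- `U'`.
  have hfix : ∀ r, ¬ Γ.Collinear r x → g.1 r = r := by
    intro r hr
    have hrU : ¬ Γ.Inc r U := fun hrU => hr ⟨U, hrU, hxU⟩
    have hrU' : ¬ Γ.Inc r U' := fun hrU => hr ⟨U', hrU, hxU'⟩
    obtain ⟨y, ⟨hyU, K, hyK, hrK⟩, -⟩ := h.proj r U hrU
    obtain ⟨y', ⟨hyU', K', hyK', hrK'⟩, -⟩ := h.proj r U' hrU'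
    have hKK' : K ≠ K' := by
      rintro rfl
      have hxK : ¬ Γ.Inc x K := fun hxK => hr ⟨K, hrK, hxK⟩
      obtain rfl := h.no_triangle hxK hyK hyK' hxU hyU hxU' hyU'
      exact hUU' (h.line_unique x y U U' (fun hxy => hxK (hxy ▸ hyK)) hxU hyU hxU' hyU')
    exact h.point_unique hKK' (inc_map_of_fix hg.1 (hg.2 K ⟨y, hyK, hyU⟩) hrK)
      (inc_map_of_fix hg.1 (hg'.2 K' ⟨y', hyK', hyU'⟩) hrK') hrK hrK'
  -- Apart from `v`, the points of `N` are not collinear with `x`, hence fixed; so `N` is fixed, and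
  -- `v` is where it meets the fixed line `V`.
  obtain ⟨N, hvN, hNV, -⟩ := h.exists_third_line ht v V V
  have hxN : ¬ Γ.Inc x N := fun hxN => hNV (h.line_unique v x N V hvx hvN hxN hvV hxV)
  have hN : ∀ r, Γ.Inc r N → r ≠ v → g.1 r = r := by
    rintro r hrN hrv
    refine hfix r ?_
    rintro ⟨M, hrM, hxM⟩
    exact hrv (h.no_triangle hxN hrN hvN hxM hrM hxV hvV)
  obtain ⟨r₁, hr₁, hr₁v⟩ := h.exists_point_notMem hs N {v} (Set.finite_singleton v)
  obtain ⟨r₂, hr₂, hr₂v⟩ := h.exists_point_notMem hs N {v, r₁} (Set.toFinite _)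
  simp only [Set.mem_singleton_iff, Set.mem_insert_iff, not_or] at hr₁v hr₂v
  have h1 := (hg.1 r₁ N).mpr hr₁
  have h2 := (hg.1 r₂ N).mpr hr₂
  rw [hN r₁ hr₁ hr₁v] at h1
  rw [hN r₂ hr₂ hr₂v.1] at h2
  have hgN : g.2 N = N := h.line_unique r₂ r₁ _ _ hr₂v.2 h2 h1 hr₂ hr₁
  exact h.point_unique hNV (inc_map_of_fix hg.1 hgN hvN) (inc_map_of_fix hg.1 hV hvV) hvN hvV

end IsGQ

/-! ### Rigidity of a line meeting an axis of symmetry -/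

/-- The permutations of the points different from `x` on `V` induced by the symmetries with
axis `U`. -/
def symmetryGroupOn (Γ : PointLineGeometry P L) (U V : L) (x : P) :
    Subgroup (Equiv.Perm {p : P // Γ.Inc p V ∧ p ≠ x}) where
  carrier := {σ | ∃ g, Γ.IsSymmetry U g ∧ ∀ p, g.1 p.1 = (σ p).1}
  one_mem' := ⟨1, ⟨Γ.Aut.one_mem, fun _ _ => rfl⟩, fun _ => rfl⟩
  mul_mem' := by
    rintro σ τ ⟨g, hg, hgσ⟩ ⟨k, hk, hkτ⟩
    exact ⟨g * k, hg.mul hk, fun p => by simp [hkτ, hgσ]⟩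
  inv_mem' := by
    rintro σ ⟨g, hg, hgσ⟩
    refine ⟨g⁻¹, hg.inv, fun p => Equiv.Perm.inv_eq_iff_eq.mpr ?_⟩
    simpa using (hgσ (σ⁻¹ p)).symm

/-- The permutation of the points different from `x` on `V` induced by an automorphism that fixes
`V` and `x`. -/
def inducedPerm {V : L} {x : P} (g : Equiv.Perm P × Equiv.Perm L) (hg : g ∈ Γ.Aut)
    (hV : g.2 V = V) (hx : g.1 x = x) : Equiv.Perm {p : P // Γ.Inc p V ∧ p ≠ x} :=
  g.1.subtypePerm fun p => by
    have h1 := hg p V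
    rw [hV] at h1
    have h2 : g.1 p = x ↔ p = x := by
      rw [← hx, g.1.apply_eq_iff_eq, hx]
    rw [h1, ne_eq, h2]

namespace IsGQ

variable {s : Cardinal.{u}} {t : Cardinal.{v}}

/-- If an axis of symmetry `U ≠ V` meets `V` in `x`, then an automorphism that fixes `V`, `x` and
almost all points of `V` fixes all points of `V`. -/
theorem fixes_line_of_axis (h : Γ.IsGQ s t) (hs : ℵ₀ ≤ s) (ht : 2 ≤ t) {U V : L} {x : P}
    (hUV : U ≠ V) (hxU : Γ.Inc x U) (hxV : Γ.Inc x V) (hU : Γ.IsAxisOfSymmetry U)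
    {θ : Equiv.Perm P × Equiv.Perm L} (hθ : θ ∈ Γ.Aut) (hθV : θ.2 V = V) (hθx : θ.1 x = x)
    (hfin : {p | Γ.Inc p V ∧ θ.1 p ≠ p}.Finite) {p : P} (hp : Γ.Inc p V) : θ.1 p = p := by
  have hoff : ∀ {K : L}, K ≠ V → Γ.Inc x K → ∀ {q}, Γ.Inc q V → q ≠ x → ¬ Γ.Inc q K :=
    fun hK hxK _ hq hqx hqK => hqx (h.point_unique hK hqK hq hxK hxV)
  have hxU' : Γ.Inc x (θ.2 U) := by
    have := (hθ x U).mpr hxU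
    rwa [hθx] at this
  have hU'V : θ.2 U ≠ V := fun hc => hUV (θ.2.injective (hc.trans hθV.symm))
  have : Infinite {p : P // Γ.Inc p V ∧ p ≠ x} := by
    have hinf : {p | Γ.Inc p V}.Infinite := Set.infinite_coe_iff.mp (h.infinite_points hs V)
    exact Set.infinite_coe_iff.mpr (hinf.sdiff (Set.finite_singleton x))
  have hone : inducedPerm θ hθ hθV hθx = 1 := by
    refine perm_eq_one_of_conj_semiregular (G := Γ.symmetryGroupOn U V x)
      (G' := Γ.symmetryGroupOn (θ.2 U) V x) ?_ ?_ _ ?_ ?_ ?_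
    · intro p q
      obtain ⟨g, hg, hgp⟩ := hU V ⟨x, hxV, hxU⟩ hUV.symm p q p.2.1 (hoff hUV hxU p.2.1 p.2.2)
        q.2.1 (hoff hUV hxU q.2.1 q.2.2)
      have hgV := hg.2 V ⟨x, hxV, hxU⟩
      have hgU := hg.2 U ⟨x, hxU, hxU⟩
      have hgx : g.1 x = x := h.point_unique hUV (inc_map_of_fix hg.1 hgU hxU)
        (inc_map_of_fix hg.1 hgV hxV) hxU hxV
      exact ⟨inducedPerm g hg.1 hgV hgx, ⟨g, hg, fun _ => rfl⟩, Subtype.ext hgp⟩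
    · rintro σ ⟨g, hg, hgσ⟩ p hp
      ext q
      rw [← hgσ]
      exact h.symmetry_semiregular hs ht ⟨x, hxV, hxU⟩ hg (by rw [hgσ, hp]) p.2.1
        (hoff hUV hxU p.2.1 p.2.2) q.2.1 (hoff hUV hxU q.2.1 q.2.2)
    · refine (hfin.preimage (f := Subtype.val) Subtype.val_injective.injOn).subset ?_
      intro p hp
      exact ⟨p.2.1, fun hc => hp (Subtype.ext hc)⟩
    · rintro σ ⟨g, hg, hgσ⟩
      refine ⟨_, hg.conj hθ, fun p => ?_⟩
      have : (θ⁻¹).1 p.1 = ((inducedPerm θ hθ hθV hθx)⁻¹ p).1 :=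
        Equiv.Perm.inv_eq_iff_eq.mpr (congrArg Subtype.val
          ((inducedPerm θ hθ hθV hθx).apply_symm_apply p)).symm
      simp only [Prod.fst_mul, Equiv.Perm.mul_apply, this, hgσ]
      rfl
    · by_cases hUU' : U = θ.2 U
      · exact Or.inl (by rw [← hUU'])
      · right
        rintro σ ⟨g, hg, hgσ⟩ τ ⟨k, hk, hkτ⟩
        -- Each of `g` and `k` fixes the other's axis, so their commutator is a symmetry for both
        -- axes and acts trivially on `V`.
        have hgU' : g.2 (θ.2 U) = θ.2 U := hg.2 _ ⟨x, hxU', hxU⟩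
        have hkU : k.2 U = U := hk.2 _ ⟨x, hxU, hxU'⟩
        have c1 := (hg.inv.conj hk.1)
        rw [hkU] at c1
        have c1 := hg.mul c1
        have c2 := (hk.conj hg.1)
        rw [hgU'] at c2
        have c2 := c2.mul hk.inv
        have c1' : Γ.IsSymmetry U (g * k * g⁻¹ * k⁻¹) := by simpa [mul_assoc] using c1
        ext p
        have hq := h.symmetry_two_axes hs ht hUU' hxU hxU' hxV ((τ * σ) p).2.1 ((τ * σ) p).2.2
          c1' c2
        have e1 : ((τ * σ) p).1 = k.1 (g.1 p) := by simp [hkτ, hgσ]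
        have e2 : ((σ * τ) p).1 = g.1 (k.1 p) := by simp [hkτ, hgσ]
        rw [e2, e1]
        rw [e1] at hq
        simpa using hq
  by_cases hpx : p = x
  · rw [hpx, hθx]
  · exact congrArg Subtype.val (DFunLike.congr_fun hone ⟨p, hp, hpx⟩)

end IsGQ

/-! ### Cofinite sublines and transpositions -/

theorem isOpenDense_iff (Γ : PointLineGeometry P L) (U : L) [Infinite (Γ.PointsOn U)]
    (B : Set (Γ.PointsOn U)) : Γ.IsOpenDense U B ↔ Bᶜ.Finite := by
  have : Infinite (CofiniteTopology (Γ.PointsOn U)) :=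
    Infinite.of_injective CofiniteTopology.of CofiniteTopology.of.injective
  have hpre : (CofiniteTopology.of.symm ⁻¹' B)ᶜ.Finite ↔ Bᶜ.Finite := by
    rw [← Set.preimage_compl]
    exact ⟨fun hf => hf.of_preimage CofiniteTopology.of.symm.surjective,
      fun hf => hf.preimage CofiniteTopology.of.symm.injective.injOn⟩
  constructor
  · rintro ⟨ho, hd⟩
    exact hpre.mp (CofiniteTopology.isOpen_iff.mp ho hd.nonempty)
  · intro hB
    rw [← hpre] at hB
    refine ⟨CofiniteTopology.isOpen_iff.mpr fun _ => hB, ?_⟩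
    rw [dense_iff_inter_open]
    intro O hO hne
    have hOf := CofiniteTopology.isOpen_iff.mp hO hne
    by_contra hcon
    rw [Set.not_nonempty_iff_eq_empty] at hcon
    refine Set.infinite_univ ((hOf.union hB).subset fun y _ => ?_)
    by_contra hy
    simp only [Set.mem_union, Set.mem_compl_iff, not_or, not_not] at hy
    exact Set.eq_empty_iff_forall_notMem.mp hcon y hy

/-- A line of a generalized quadrangle with infinite lines that has a fully symmetric open dense
subline does not meet any other axis of symmetry. -/
theorem IsGQ.not_axis_of_fullySymmetric {s : Cardinal.{u}} {t : Cardinal.{v}} (h : Γ.IsGQ s t)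
    (hs : ℵ₀ ≤ s) (ht : 2 ≤ t) {U V : L} {x : P} (hUV : U ≠ V) (hxU : Γ.Inc x U)
    (hxV : Γ.Inc x V) (hV : Γ.HasFullySymmetricOpenSubline V) : ¬ Γ.IsAxisOfSymmetry U := by
  intro hU
  obtain ⟨W, hW, hsym⟩ := hV
  have hinfV := h.infinite_points hs V
  rw [isOpenDense_iff] at hW
  set x' : Γ.PointsOn V := ⟨x, hxV⟩
  have hWinf : W.Infinite := by simpa using hW.infinite_compl
  obtain ⟨w₀, hw₀, hw₀x⟩ := hWinf.exists_notMem_finite (Set.finite_singleton x')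
  have hIinf : (W \ {x', w₀}).Infinite := hWinf.sdiff (Set.toFinite _)
  have := Set.infinite_coe_iff.mpr hIinf
  -- All the transpositions used share the point `w₀`; each is lifted to an automorphism `θ w`.
  classical
  let sw : (W \ {x', w₀} : Set _) → Equiv.Perm W := fun w => Equiv.swap ⟨w₀, hw₀⟩ ⟨w.1, w.2.1⟩
  have hex : ∀ w, sw w ∈ Γ.sublineGroup V W := fun w => by rw [hsym]; trivial
  choose θ hθ hθV hθW using hex
  -- `W` need not contain `x`, so `θ w` may move `x`, but only within a finite set. By pigeonhole
  -- two of the lifts agree at `x`, and their quotient fixes it.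
  have hmem : ∀ w, (⟨(θ w).1 x, inc_map_of_fix (hθ w) (hθV w) hxV⟩ : Γ.PointsOn V) ∈
      Wᶜ ∪ {x'} := by
    intro w
    by_cases hx : x' ∈ W
    · right
      refine Subtype.ext ((hθW w ⟨x', hx⟩).trans ?_)
      have : sw w ⟨x', hx⟩ = ⟨x', hx⟩ := by
        refine Equiv.swap_apply_of_ne_of_ne ?_ ?_
        · intro hc
          exact hw₀x (congrArg Subtype.val hc).symm
        · intro hc
          exact w.2.2 (Or.inl (congrArg Subtype.val hc).symm)
      rw [this]
    · left
      intro hc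
      have h1 := hθW w ((sw w).symm ⟨_, hc⟩)
      rw [Equiv.apply_symm_apply] at h1
      have h2 : ((sw w).symm ⟨_, hc⟩).1 = x' := Subtype.ext ((θ w).1.injective h1)
      exact hx (h2 ▸ ((sw w).symm ⟨_, hc⟩).2)
  have := ((hW.union (Set.finite_singleton x')).to_subtype :
    Finite (Wᶜ ∪ {x'} : Set (Γ.PointsOn V)))
  obtain ⟨w₁, w₂, hne, heq⟩ := Finite.exists_ne_map_eq_of_infinite
    fun w => (⟨_, hmem w⟩ : (Wᶜ ∪ {x'} : Set (Γ.PointsOn V)))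
  have heq : (θ w₁).1 x = (θ w₂).1 x := congrArg (fun y => y.1.1) heq
  have hfix : ∀ y : Γ.PointsOn V, y ∈ W → y ≠ w₀ → y ≠ w₁ → y ≠ w₂ →
      ((θ w₂)⁻¹ * θ w₁).1 y = y := by
    intro y hyW hy0 hy1 hy2
    have e : ∀ w : (W \ {x', w₀} : Set _), y ≠ w → (θ w).1 y = y := fun w hyw => by
      rw [hθW w ⟨y, hyW⟩]
      have : sw w ⟨y, hyW⟩ = ⟨y, hyW⟩ := Equiv.swap_apply_of_ne_of_ne
        (fun hc => hy0 (congrArg Subtype.val hc)) (fun hc => hyw (congrArg Subtype.val hc))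
      rw [this]
    simp only [Prod.fst_mul, Prod.fst_inv, Equiv.Perm.mul_apply]
    rw [e w₁ hy1]
    exact Equiv.Perm.inv_eq_iff_eq.mpr (e w₂ hy2).symm
  have hfin : {p | Γ.Inc p V ∧ ((θ w₂)⁻¹ * θ w₁).1 p ≠ p}.Finite := by
    refine ((hW.union (Set.toFinite {w₀, w₁.1, w₂.1})).image Subtype.val).subset ?_
    rintro p ⟨hp, hpne⟩
    refine ⟨⟨p, hp⟩, ?_, rfl⟩
    by_contra hcon
    simp only [Set.mem_union, Set.mem_compl_iff, not_or, not_not, Set.mem_insert_iff,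
      Set.mem_singleton_iff] at hcon
    exact hpne (hfix ⟨p, hp⟩ hcon.1 hcon.2.1 hcon.2.2.1 hcon.2.2.2)
  have hall := h.fixes_line_of_axis hs ht hUV hxU hxV hU
    (Γ.Aut.mul_mem (Γ.Aut.inv_mem (hθ w₂)) (hθ w₁))
    (by
      simp only [Prod.snd_mul, Prod.snd_inv, Equiv.Perm.mul_apply, hθV]
      exact Equiv.Perm.inv_eq_iff_eq.mpr (hθV w₂).symm)
    (by
      simp only [Prod.fst_mul, Prod.fst_inv, Equiv.Perm.mul_apply]
      exact Equiv.Perm.inv_eq_iff_eq.mpr heq) hfin w₀.2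
  simp only [Prod.fst_mul, Prod.fst_inv, Equiv.Perm.mul_apply] at hall
  have hall := Equiv.Perm.inv_eq_iff_eq.mp hall
  -- The quotient is trivial on `V`, although the two lifts send `w₀` to different points.
  have e : ∀ w, (θ w).1 w₀ = w.1 := fun w => by
    rw [hθW w ⟨w₀, hw₀⟩]
    simp [sw]
  rw [e, e] at hall
  exact hne (Subtype.ext (Subtype.ext hall))

theorem IsGQ.not_isTGQ_of_fullySymmetric {s : Cardinal.{u}} {t : Cardinal.{v}} (h : Γ.IsGQ s t)
    (hs : ℵ₀ ≤ s) (ht : 2 ≤ t) {V : L} (hV : Γ.HasFullySymmetricOpenSubline V) : ¬ Γ.IsTGQ := by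
  rintro ⟨x, hx⟩
  by_cases hxV : Γ.Inc x V
  · obtain ⟨U, hxU, hUV, -⟩ := h.exists_third_line ht x V V
    exact h.not_axis_of_fullySymmetric hs ht hUV hxU hxV hV (hx U hxU)
  · obtain ⟨y, ⟨hyV, U, hyU, hxU⟩, -⟩ := h.proj x V hxV
    exact h.not_axis_of_fullySymmetric hs ht (fun hc : U = V => hxV (hc ▸ hxU)) hyU hyV hV (hx U hxU)

/-! ### The abstract line -/

theorem sublineGroup_abstractLine (A : Type u)
    (B : Set ((abstractLine.{u, v} A).PointsOn PUnit.unit)) :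
    (abstractLine.{u, v} A).sublineGroup PUnit.unit B = ⊤ := by
  classical
  rw [eq_top_iff]
  intro σ _
  let e : (abstractLine.{u, v} A).PointsOn PUnit.unit ≃ A := Equiv.subtypeUnivEquiv fun _ => trivial
  -- Extension by the identity off `B`: incidence always holds, so any permutation of the points is
  -- an automorphism.
  refine ⟨(e.permCongr (Equiv.Perm.ofSubtype σ), 1), fun _ _ => Iff.rfl, rfl, fun b => ?_⟩
  have : e.permCongr (Equiv.Perm.ofSubtype σ) (e b.1) = e (σ b).1 := by
    rw [Equiv.permCongr_apply, Equiv.symm_apply_apply, Equiv.Perm.ofSubtype_apply_coe]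
  exact this

/-- The abstract line is birationally equivalent to `V` if and only if `V` has a fully symmetric
open dense subline. -/
theorem linesBirational_abstractLine_iff (V : L) [Infinite (Γ.PointsOn V)] (A : Type u)
    (hA : #A = #(Γ.PointsOn V)) :
    (abstractLine.{u, v} A).LinesBirational PUnit.unit Γ V ↔
      Γ.HasFullySymmetricOpenSubline V := by
  let f : (abstractLine.{u, v} A).PointsOn PUnit.unit ≃ A := Equiv.subtypeUnivEquiv fun _ => trivial
  obtain ⟨k⟩ := Cardinal.eq.mp hA
  constructor
  · rintro ⟨B, C, -, hC, e, he⟩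
    refine ⟨C, hC, ?_⟩
    rw [eq_top_iff]
    intro τ _
    have := (he (e.permCongr.symm τ)).mp (by rw [sublineGroup_abstractLine]; trivial)
    rwa [Equiv.apply_symm_apply] at this
  · rintro ⟨W, hW, hsym⟩
    let j := f.trans k
    have : Infinite ((abstractLine.{u, v} A).PointsOn PUnit.unit) := j.infinite_iff.mpr inferInstance
    refine ⟨j ⁻¹' W, W, ?_, hW, j.subtypeEquiv fun _ => Iff.rfl, fun σ => ?_⟩
    · rw [isOpenDense_iff] at hW ⊢
      exact hW.preimage j.injective.injOn
    · rw [sublineGroup_abstractLine, hsym]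
      exact ⟨fun _ => trivial, fun _ => trivial⟩

end PointLineGeometry

theorem mainTheorem3 {P : Type u} {L : Type v} (Y : PointLineGeometry P L)
    (ℓ : Cardinal.{u}) (t : Cardinal.{v}) (hY : Y.IsGQ ℓ t) (hℓ : ℵ₀ ≤ ℓ) (ht : 2 ≤ t) (V : L)
    (A : Type u) (hA : #A = ℓ + 1) :
    ((PointLineGeometry.abstractLine.{u, v} A).LinesBirational PUnit.unit Y V ↔
        Y.HasFullySymmetricOpenSubline V) ∧
      ((PointLineGeometry.abstractLine.{u, v} A).LinesBirational PUnit.unit Y V →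
        ¬ Y.IsTGQ) := by
  have := hY.infinite_points hℓ V
  have h := PointLineGeometry.linesBirational_abstractLine_iff (Γ := Y) V A
    (hA.trans (hY.card_points V).symm)
  exact ⟨h, fun hb => hY.not_isTGQ_of_fullySymmetric hℓ ht (h.mp hb)⟩
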